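/- All rings are associative. Let $R$ be a unital ring. Elements $x,y\in R$ are centrally orthogonal, written $x\perp y$, if $xRy=yRx=0$. An element $u\in R$ is quasi-invertible if $(1-uv)\perp(1-vu)$ for some $v\in R$; the set of quasi-invertible elements is denoted $R_q^{-1}$. One can then choose $v$ such that moreover $u=uvu$ and $v=vuv$; such a $v$ is called a quasi-inverse of $u$, and the idempotents $1-uv$ and $1-vu$ are called defect idempotents (of $R$). The ring $R$ is a QB-ring if whenever $Ra+Rb=R$ there is $y\in R$ with $a+yb\in R_q^{-1}$. A two-sided ideal $I$ of $R$ is a QB-ideal if whenever $xa-x-a+b=0$ with $x,a,b\in I$ there is $y\in I$ with $1-(a-yb)\in R_q^{-1}$. For idempotents $p,q\in R$ with $pRq\neq 0$, let $(pRq)_q^{-1}$ be the set of $x\in pRq$ such that $(p-xy)\perp(q-yx)$ for some $y\in qRp$. Then $pRq$ is a QB-corner if $pRq\ne0$ and, for every $a\in pRq$: (1) whenever $xa+b=q$ with $x\in qRp$ and $b\in qRq$, there is $y\in pRq$ with $a+yb\in(pRq)_q^{-1}$; and (2) whenever $ax+b=p$ with $x\in qRp$ and $b\in pRp$, there is $y\in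 pRq$ with $a+by\in(pRq)_q^{-1}$. **Theorem.** Let $R$ be a unital ring and let $I$ be a two-sided ideal of $R$. Then $R$ is a QB-ring if and only if the following three conditions hold: (i) $R/I$ is a QB-ring; (ii) $(R/I)_q^{-1}=(R_q^{-1}+I)/I$, that is, the quasi-invertible elements of $R/I$ are exactly the images of the quasi-invertible elements of $R$; (iii) $I$ is a QB-ideal, and for all defect idempotents $p$ and $q$ of $R$ (not necessarily associated with the same quasi-invertible element) with $p\in I$ or $q\in I$, either $p\perp q$ or else $pRq$ is a QB-corner. -/

import Mathlib

namespace QBRing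

/-- `x ⊥ y`: the elements `x` and `y` are centrally orthogonal, that is `xRy = yRx = 0`. -/
def CentrallyOrthogonal {R : Type*} [Ring R] (x y : R) : Prop :=
  (∀ r : R, x * r * y = 0) ∧ (∀ r : R, y * r * x = 0)

/-- The set `R_q⁻¹` of quasi-invertible elements of a unital ring `R`: those `u` for which
there is some `v` with `(1 - uv) ⊥ (1 - vu)`. -/
def quasiInvertibles (R : Type*) [Ring R] : Set R :=
  {u | ∃ v : R, CentrallyOrthogonal (1 - u * v) (1 - v * u)}

/-- `v` is a quasi-inverse for `u`: `(1 - uv) ⊥ (1 - vu)`, with `u = uvu` and `v = vuv`, so that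
`1 - uv` and `1 - vu` are idempotents. (In a ring that is not semiprime the equation `u = uvu` is
not a consequence of `(1 - uv) ⊥ (1 - vu)`, but `v` can always be chosen so that it holds,
see `mem_quasiInvertibles_iff`.) -/
def IsQuasiInverse {R : Type*} [Ring R] (u v : R) : Prop :=
  u * v * u = u ∧ v * u * v = v ∧ CentrallyOrthogonal (1 - u * v) (1 - v * u)

theorem mem_quasiInvertibles_iff {R : Type*} [Ring R] (u : R) :
    u ∈ quasiInvertibles R ↔ ∃ v : R, IsQuasiInverse u v := by
  constructor
  · rintro ⟨v, h1, h2⟩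
    set z : R := 2 * v - v * u * v with hz
    have hP : 1 - u * z = (1 - u * v) * (1 - u * v) := by rw [hz]; noncomm_ring
    have hQ : 1 - z * u = (1 - v * u) * (1 - v * u) := by rw [hz]; noncomm_ring
    have hu : u * z * u = u := by
      have h3 : (1 - u * z) * u = (1 - u * v) * u * (1 - v * u) := by rw [hP]; noncomm_ring
      rw [h1, sub_mul, one_mul, sub_eq_zero] at h3
      exact h3.symm
    have ha : u * (z * u * z) = u * z := by
      rw [← mul_assoc, ← mul_assoc, hu]
    have hb : z * u * z * u = z * u := by
      rw [mul_assoc, mul_assoc, ← mul_assoc u, hu]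
    refine ⟨z * u * z, ?_, ?_, ?_, ?_⟩
    · rw [ha, hu]
    · rw [hb, mul_assoc, ha, ← mul_assoc]
    · intro r
      rw [ha, hb, hP, hQ]
      have := h1 ((1 - u * v) * r * (1 - v * u))
      simpa only [mul_assoc] using this
    · intro r
      rw [ha, hb, hP, hQ]
      have := h2 ((1 - v * u) * r * (1 - u * v))
      simpa only [mul_assoc] using this
  · rintro ⟨v, -, -, h⟩
    exact ⟨v, h⟩

/-- `p` is a defect idempotent of `R`: it is one of the two idempotents `1 - uv`, `1 - vu`
associated with a quasi-invertible element `u` and a quasi-inverse `v` of `u`. -/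
def IsDefectIdempotent {R : Type*} [Ring R] (p : R) : Prop :=
  ∃ u v : R, IsQuasiInverse u v ∧ (p = 1 - u * v ∨ p = 1 - v * u)

/-- A unital ring `R` is a QB-ring if whenever `Ra + Rb = R` there is an element `y` such that
`a + yb` is quasi-invertible. -/
def IsQBRing (R : Type*) [Ring R] : Prop :=
  ∀ a b : R, (∃ x z : R, x * a + z * b = 1) → ∃ y : R, a + y * b ∈ quasiInvertibles R

/-- An ideal `I` of the unital ring `R` is a QB-ideal (equivalently `I` is a QB-ring, as a possibly
non-unital ring) if whenever `xa - x - a + b = 0` with `x`, `a`, `b` in `I` there is an element `y`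
in `I` such that `1 - (a - yb)` is quasi-invertible in `R`. -/
def IsQBIdeal {R : Type*} [Ring R] (I : Ideal R) : Prop :=
  ∀ x ∈ I, ∀ a ∈ I, ∀ b ∈ I, x * a - x - a + b = 0 →
    ∃ y ∈ I, 1 - (a - y * b) ∈ quasiInvertibles R

/-- The skew corner `pRq`. -/
def skewCorner {R : Type*} [Ring R] (p q : R) : Set R :=
  {x | ∃ r : R, x = p * r * q}

/-- The set `(pRq)_q⁻¹` of quasi-invertible elements of the skew corner `pRq`. -/
def cornerQuasiInvertibles {R : Type*} [Ring R] (p q : R) : Set R :=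
  {x | x ∈ skewCorner p q ∧
    ∃ y ∈ skewCorner q p, CentrallyOrthogonal (p - x * y) (q - y * x)}

/-- The set `cl~((pRq)_q⁻¹)`. -/
def cornerCl {R : Type*} [Ring R] (p q : R) : Set R :=
  {a | a ∈ skewCorner p q ∧
    ∀ x ∈ skewCorner q p, ∀ b ∈ skewCorner q q, x * a + b = q →
      ∃ y ∈ skewCorner p q, a + y * b ∈ cornerQuasiInvertibles p q}

/-- The set `cr~((pRq)_q⁻¹)`, the left-right mirror image of `cl~((pRq)_q⁻¹)`. -/
def cornerCr {R : Type*} [Ring R] (p q : R) : Set R :=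
  {a | a ∈ skewCorner p q ∧
    ∀ x ∈ skewCorner q p, ∀ b ∈ skewCorner p p, a * x + b = p →
      ∃ y ∈ skewCorner p q, a + b * y ∈ cornerQuasiInvertibles p q}

/-- For idempotents `p`, `q` of `R`: the skew corner `pRq` is non-zero and is a QB-corner. -/
def IsQBCorner {R : Type*} [Ring R] (p q : R) : Prop :=
  skewCorner p q ≠ {0} ∧ cornerCl p q = skewCorner p q ∧ cornerCr p q = skewCorner p q

end QBRing

namespace QBRing

variable {R : Type*} [Ring R]

/-! Everything rests on exhibiting a partner whose two defects factor through elements already known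
to be centrally orthogonal, since two-sided multiples and sums preserve ⊥.

If R is a QB-ring, an element of a corner cut out by defect idempotents is completed to an element
of R, corrected there, and cut down again. Quasi-invertibles lift from a quotient because the
correcting factor 1 + n, unipotent only modulo the kernel, can be replaced by a unipotent unit of R.

For the converse, (i) and (ii) reduce the problem to u + i with u quasi-invertible and i in I. The
QB-ideal condition and unipotent multiplications bring this to α + uc, where c ∈ 1 + I is
quasi-invertible and α lies in a corner between defect idempotents of u and c. One corner condition
repairs α. The product uc need not be quasi-invertible; a second, complementary corner repairs it
(`exists_regularization_mul`). -/

theorem mul_mul_of_mul_eq {a b c : R} (h : a * b = c) (r : R) : a * (b * r) = c * r := by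
  rw [← mul_assoc, h]

/-! ### Central orthogonality, defect idempotents and multiplication by units. -/

namespace CentrallyOrthogonal

theorem symm {x y : R} (h : CentrallyOrthogonal x y) : CentrallyOrthogonal y x :=
  ⟨h.2, h.1⟩

theorem mul_mul {x y : R} (h : CentrallyOrthogonal x y) (a b c d : R) :
    CentrallyOrthogonal (a * x * b) (c * y * d) := by
  constructor
  · intro r
    have := h.1 (b * r * c)
    calc a * x * b * r * (c * y * d) = a * (x * (b * r * c) * y) * d := by noncomm_ring
      _ = 0 := by rw [this]; simp
  · intro r
    have := h.2 (d * r * a)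
    calc c * y * d * r * (a * x * b) = c * (y * (d * r * a) * x) * b := by noncomm_ring
      _ = 0 := by rw [this]; simp

theorem add_right {x y z : R} (h : CentrallyOrthogonal x y) (h' : CentrallyOrthogonal x z) :
    CentrallyOrthogonal x (y + z) :=
  ⟨fun r => by rw [mul_add, h.1, h'.1, add_zero],
    fun r => by rw [add_mul, add_mul, h.2, h'.2, add_zero]⟩

theorem add_left {x y z : R} (h : CentrallyOrthogonal x z) (h' : CentrallyOrthogonal y z) :
    CentrallyOrthogonal (x + y) z :=
  (h.symm.add_right h'.symm).symm

theorem map {S : Type*} [Ring S] {f : R →+* S} (hf : Function.Surjective f) {x y : R}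
    (h : CentrallyOrthogonal x y) : CentrallyOrthogonal (f x) (f y) := by
  constructor <;> intro r <;> obtain ⟨r, rfl⟩ := hf r
  · rw [← map_mul, ← map_mul, h.1, map_zero]
  · rw [← map_mul, ← map_mul, h.2, map_zero]

end CentrallyOrthogonal

theorem IsQuasiInverse.symm {u v : R} (h : IsQuasiInverse u v) : IsQuasiInverse v u :=
  ⟨h.2.1, h.1, h.2.2.symm⟩

theorem IsDefectIdempotent.exists_eq {p : R} (h : IsDefectIdempotent p) :
    ∃ u v : R, IsQuasiInverse u v ∧ p = 1 - u * v := by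
  obtain ⟨u, v, huv, h | h⟩ := h
  · exact ⟨u, v, huv, h⟩
  · exact ⟨v, u, huv.symm, h⟩

theorem IsQuasiInverse.idem {u v : R} (h : IsQuasiInverse u v) :
    (1 - u * v) * (1 - u * v) = 1 - u * v := by
  linear_combination (norm := noncomm_ring) h.1 * v

theorem IsDefectIdempotent.idem {p : R} (h : IsDefectIdempotent p) : p * p = p := by
  obtain ⟨u, v, huv, rfl⟩ := h.exists_eq
  exact huv.idem

theorem map_mem_quasiInvertibles {S : Type*} [Ring S] {f : R →+* S} (hf : Function.Surjective f)
    {u : R} (h : u ∈ quasiInvertibles R) : f u ∈ quasiInvertibles S := by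
  obtain ⟨v, hv⟩ := h
  exact ⟨f v, by simpa using hv.map hf⟩

theorem mul_mem_quasiInvertibles {g g' u : R} (h1 : g * g' = 1) (h2 : g' * g = 1)
    (h : u ∈ quasiInvertibles R) : g * u ∈ quasiInvertibles R := by
  obtain ⟨v, hv⟩ := h
  refine ⟨v * g', ?_⟩
  have e1 : 1 - g * u * (v * g') = g * (1 - u * v) * g' := by
    linear_combination (norm := noncomm_ring) - h1
  have e2 : 1 - v * g' * (g * u) = 1 * (1 - v * u) * 1 := by
    linear_combination (norm := noncomm_ring) - v * h2 * u
  rw [e1, e2]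
  exact hv.mul_mul _ _ _ _

theorem mem_quasiInvertibles_mul {g g' u : R} (h1 : g * g' = 1) (h2 : g' * g = 1)
    (h : u ∈ quasiInvertibles R) : u * g ∈ quasiInvertibles R := by
  obtain ⟨v, hv⟩ := h
  refine ⟨g' * v, ?_⟩
  have e1 : 1 - u * g * (g' * v) = 1 * (1 - u * v) * 1 := by
    linear_combination (norm := noncomm_ring) - u * h1 * v
  have e2 : 1 - g' * v * (u * g) = g' * (1 - v * u) * g := by
    linear_combination (norm := noncomm_ring) - h2
  rw [e1, e2]
  exact hv.mul_mul _ _ _ _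

/-! ### Skew corners. -/

theorem mem_skewCorner_iff {p q : R} (hp : p * p = p) (hq : q * q = q) {x : R} :
    x ∈ skewCorner p q ↔ p * x = x ∧ x * q = x := by
  constructor
  · rintro ⟨r, rfl⟩
    exact ⟨by rw [← mul_assoc, ← mul_assoc, hp], by rw [mul_assoc, hq]⟩
  · rintro ⟨h1, h2⟩
    exact ⟨x, by rw [h1, h2]⟩

-- Left-right symmetry: the same y serves on either side, because both new defects are two-sided
-- multiples of the old ones. Hence only the left corner condition is ever established or used
-- directly.
set_option linter.unusedSimpArgs false in
theorem add_sub_mul_mem_cornerQuasiInvertibles {p q a x y : R} (hp : p * p = p) (hq : q * q = q)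
    (ha : a ∈ skewCorner p q) (hx : x ∈ skewCorner q p) (hy : y ∈ skewCorner p q)
    (h : a + y * (q - x * a) ∈ cornerQuasiInvertibles p q) :
    a + (p - a * x) * y ∈ cornerQuasiInvertibles p q := by
  obtain ⟨-, v, hv, h⟩ := h
  rw [mem_skewCorner_iff hp hq] at ha hy
  rw [mem_skewCorner_iff hq hp] at hx hv
  obtain ⟨pa, aq⟩ := ha
  obtain ⟨qx, xp⟩ := hx
  obtain ⟨py, yq⟩ := hy
  obtain ⟨qv, vp⟩ := hv
  have R1 := mul_mul_of_mul_eq pa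
  have R2 := mul_mul_of_mul_eq aq
  have R3 := mul_mul_of_mul_eq qx
  have R4 := mul_mul_of_mul_eq xp
  have R5 := mul_mul_of_mul_eq py
  have R6 := mul_mul_of_mul_eq yq
  have R7 := mul_mul_of_mul_eq qv
  have R8 := mul_mul_of_mul_eq vp
  refine ⟨(mem_skewCorner_iff hp hq).2 ⟨?_, ?_⟩, x + (q - x * a) * v * (p - y * x),
    (mem_skewCorner_iff hq hp).2 ⟨?_, ?_⟩, ?_⟩
  · simp only [mul_add, mul_sub, sub_mul, add_mul, mul_assoc, hp, hq, *]
  · simp only [mul_add, mul_sub, sub_mul, add_mul, mul_assoc, hp, hq, *]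
  · simp only [mul_add, mul_sub, sub_mul, add_mul, mul_assoc, hp, hq, *]
  · simp only [mul_add, mul_sub, sub_mul, add_mul, mul_assoc, hp, hq, *]
  · have e1 : p - (a + (p - a * x) * y) * (x + (q - x * a) * v * (p - y * x)) =
        (p - a * x) * (p - (a + y * (q - x * a)) * v) * (p - y * x) := by
      simp only [mul_add, mul_sub, sub_mul, add_mul, mul_assoc, hp, hq, pa, aq, qx, xp, py, yq,
        qv, vp, R1, R2, R3, R4, R5, R6, R7, R8]
      abel
    have e2 : q - (x + (q - x * a) * v * (p - y * x)) * (a + (p - a * x) * y) =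
        (q - x * a) * (q - v * (a + y * (q - x * a))) * (q - x * y) := by
      simp only [mul_add, mul_sub, sub_mul, add_mul, mul_assoc, hp, hq, pa, aq, qx, xp, py, yq,
        qv, vp, R1, R2, R3, R4, R5, R6, R7, R8]
      abel
    rw [e1, e2]
    exact h.mul_mul _ _ _ _

/-- In a QB-ring every skew corner cut out by defect idempotents satisfies the left condition. -/
theorem IsQBRing.exists_add_mul_mem (hR : IsQBRing R) {p q a x : R}
    (hp : IsDefectIdempotent p) (hq : IsDefectIdempotent q)
    (ha : a ∈ skewCorner p q) (hx : x ∈ skewCorner q p) :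
    ∃ y ∈ skewCorner p q, a + y * (q - x * a) ∈ cornerQuasiInvertibles p q := by
  have hpp := hp.idem
  have hqq := hq.idem
  rw [mem_skewCorner_iff hpp hqq] at ha
  rw [mem_skewCorner_iff hqq hpp] at hx
  obtain ⟨pa, aq⟩ := ha
  obtain ⟨qx, xp⟩ := hx
  obtain ⟨u, v, ⟨uvu, vuv, hperp⟩, hpe⟩ := hp.exists_eq
  obtain ⟨z, w, ⟨zwz, wzw, hperp'⟩, hqe⟩ := hq.exists_eq
  obtain ⟨p', hp'⟩ : ∃ p', p' = 1 - v * u := ⟨_, rfl⟩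
  obtain ⟨q', hq'⟩ : ∃ q', q' = 1 - w * z := ⟨_, rfl⟩
  rw [← hpe, ← hp'] at hperp
  rw [← hqe, ← hq'] at hperp'
  have pu : p * u = 0 := by rw [hpe, sub_mul, uvu, one_mul, sub_self]
  have vp : v * p = 0 := by rw [hpe, mul_sub, ← mul_assoc, vuv, mul_one, sub_self]
  have qz : q * z = 0 := by rw [hqe, sub_mul, zwz, one_mul, sub_self]
  have p'v : p' * v = 0 := by rw [hp', sub_mul, vuv, one_mul, sub_self]
  have xu : x * u = 0 := by rw [← xp, mul_assoc, pu, mul_zero]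
  have va : v * a = 0 := by rw [← pa, ← mul_assoc, vp, zero_mul]
  have az : a * z = 0 := by rw [← aq, mul_assoc, qz, mul_zero]
  -- Completing a by uw and x by zv leaves the corner error plus z p' w. The latter disappears after
  -- left multiplication by p y, since p ⊥ p'; so pW stays in the corner.
  have hb : 1 - (x + z * v) * (a + u * w) = (q - x * a) + z * p' * w := by
    rw [hqe, hp']
    linear_combination (norm := noncomm_ring) - xu * w - z * va
  obtain ⟨b, hbe⟩ : ∃ b, b = q - x * a := ⟨_, rfl⟩
  have qb : q * b = b := by rw [hbe, mul_sub, hqq, ← mul_assoc, qx]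
  have bq : b * q = b := by rw [hbe, sub_mul, hqq, mul_assoc, aq]
  have bz : b * z = 0 := by rw [← bq, mul_assoc, qz, mul_zero]
  rw [← hbe] at hb
  obtain ⟨y, hy⟩ := hR (a + u * w) (b + z * p' * w) ⟨x + z * v, 1, by rw [← hb]; noncomm_ring⟩
  obtain ⟨W, hW⟩ : ∃ W, W = a + u * w + y * (b + z * p' * w) := ⟨_, rfl⟩
  rw [← hW] at hy
  obtain ⟨V, hV⟩ := hy
  rw [← hbe]
  have pW : a + p * y * q * b = p * W := by
    have h1 := hperp.1 (y * z)
    rw [hW]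
    linear_combination (norm := noncomm_ring) p * y * qb - pa - pu * w - h1 * w
  have aWq : p * W * q = p * W := by
    rw [← pW]
    linear_combination (norm := noncomm_ring) aq + p * y * q * bq
  refine ⟨p * y * q, ⟨y, rfl⟩, ?_⟩
  rw [pW]
  refine ⟨⟨W, aWq.symm⟩, q * V * p, ⟨V, rfl⟩, ?_⟩
  have e1 : p - p * W * (q * V * p) = p * (1 - W * V) * p := by
    linear_combination (norm := noncomm_ring) - aWq * V * p - hpp
  -- The part of qV lost by cutting down to p is itself a multiple of the defect 1 - VW, so that
  -- defect can be factored out in `e2`.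
  have hβ : q * V * u * v = - (q * (1 - V * W) * z * v) := by
    have h1 := hperp'.1 (V * u)
    have h2 := hperp'.1 (V * y * z * p')
    have h3 : p' * w * z * v = - (p' * q' * v) := by
      rw [hq']
      linear_combination (norm := noncomm_ring) p'v
    have h4 : w * z = 1 - q' := by rw [hq']; noncomm_ring
    have h5 : u * w = W - a - y * (b + z * p' * w) := by rw [hW]; noncomm_ring
    linear_combination (norm := noncomm_ring) h1 * v - q * V * u * h4 * v
      + qz * v + q * V * h5 * z * v - q * V * az * v - q * V * y * bz * v
      - q * V * y * z * h3 + h2 * v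
  have e2 : q - q * V * p * (p * W) = q * (1 - V * W) * (q - z * v * W * q) := by
    have h1 : u * v = 1 - p := by rw [hpe]; noncomm_ring
    linear_combination (norm := noncomm_ring) hβ * W * q - q * V * hpp * W - hqq
      - q * V * h1 * W * q + q * V * aWq
  rw [e1, e2]
  exact hV.mul_mul _ _ _ _

theorem zero_mem_cornerQuasiInvertibles {p q : R} (h : CentrallyOrthogonal p q) :
    (0 : R) ∈ cornerQuasiInvertibles p q :=
  ⟨⟨0, by simp⟩, 0, ⟨0, by simp⟩, by simpa using h⟩

theorem eq_zero_of_mem_skewCorner {p q a : R} (h : CentrallyOrthogonal p q)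
    (ha : a ∈ skewCorner p q) : a = 0 := by
  obtain ⟨r, rfl⟩ := ha
  exact h.1 r

theorem exists_add_mul_mem_of_or {p q : R} (hp : p * p = p) (hq : q * q = q)
    (h : CentrallyOrthogonal p q ∨ IsQBCorner p q) {a x : R} (ha : a ∈ skewCorner p q)
    (hx : x ∈ skewCorner q p) :
    ∃ y ∈ skewCorner p q, a + y * (q - x * a) ∈ cornerQuasiInvertibles p q := by
  obtain h | ⟨-, h, -⟩ := h
  · refine ⟨0, ⟨0, by simp⟩, ?_⟩
    rw [eq_zero_of_mem_skewCorner h ha, zero_mul, add_zero]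
    exact zero_mem_cornerQuasiInvertibles h
  · rw [← h] at ha
    refine ha.2 x hx _ ?_ (add_sub_cancel _ _)
    have ha := (mem_skewCorner_iff hp hq).1 ha.1
    have hx := (mem_skewCorner_iff hq hp).1 hx
    exact (mem_skewCorner_iff hq hq).2 ⟨by rw [mul_sub, hq, ← mul_assoc, hx.1],
      by rw [sub_mul, hq, mul_assoc, ha.2]⟩

theorem exists_add_sub_mul_mem_of_or {p q : R} (hp : p * p = p) (hq : q * q = q)
    (h : CentrallyOrthogonal p q ∨ IsQBCorner p q) {a x : R} (ha : a ∈ skewCorner p q)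
    (hx : x ∈ skewCorner q p) :
    ∃ y ∈ skewCorner p q, a + (p - a * x) * y ∈ cornerQuasiInvertibles p q := by
  obtain ⟨y, hy, h⟩ := exists_add_mul_mem_of_or hp hq h ha hx
  exact ⟨y, hy, add_sub_mul_mem_cornerQuasiInvertibles hp hq ha hx hy h⟩

theorem IsQBRing.centrallyOrthogonal_or_isQBCorner (hR : IsQBRing R) {p q : R}
    (hp : IsDefectIdempotent p) (hq : IsDefectIdempotent q) :
    CentrallyOrthogonal p q ∨ IsQBCorner p q := by
  by_cases h0 : skewCorner p q = {0}
  · left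
    have hz : ∀ a ∈ skewCorner p q, a = 0 := fun a ha => by rwa [h0] at ha
    -- In a zero corner the only candidate is 0, whose defects are p and q themselves.
    obtain ⟨y, hy, -, z, -, h⟩ := hR.exists_add_mul_mem hp hq (a := 0) (x := 0)
      ⟨0, by simp⟩ ⟨0, by simp⟩
    rw [hz y hy] at h
    simpa using h
  · refine Or.inr ⟨h0, Set.Subset.antisymm (fun a ha => ha.1) fun a ha => ⟨ha, ?_⟩,
      Set.Subset.antisymm (fun a ha => ha.1) fun a ha => ⟨ha, ?_⟩⟩
    · intro x hx b _ hb
      obtain rfl := eq_sub_of_add_eq' hb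
      exact hR.exists_add_mul_mem hp hq ha hx
    · intro x hx b _ hb
      obtain rfl := eq_sub_of_add_eq' hb
      obtain ⟨y, hy, h⟩ := hR.exists_add_mul_mem hp hq ha hx
      exact ⟨y, hy, add_sub_mul_mem_cornerQuasiInvertibles hp.idem hq.idem ha hx hy h⟩

/-! ### Quotients, lifting of quasi-invertibles, and ideals. -/

theorem IsQBRing.of_surjective {S : Type*} [Ring S] {f : R →+* S} (hf : Function.Surjective f)
    (hR : IsQBRing R) : IsQBRing S := by
  rintro a b ⟨x, z, h⟩
  obtain ⟨a, rfl⟩ := hf a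
  obtain ⟨x, rfl⟩ := hf x
  obtain ⟨y, hy⟩ := hR a (1 - x * a) ⟨x, 1, by simp⟩
  refine ⟨f y * z, ?_⟩
  have := map_mem_quasiInvertibles hf hy
  rwa [map_add, map_mul, map_sub, map_one, map_mul, ← h, add_sub_cancel_left, ← mul_assoc] at this

/-- Quasi-invertible elements lift along surjections from a QB-ring. -/
theorem IsQBRing.exists_map_eq {S : Type*} [Ring S] {f : R →+* S} (hf : Function.Surjective f)
    (hR : IsQBRing R) {s : S} (hs : s ∈ quasiInvertibles S) :
    ∃ r ∈ quasiInvertibles R, f r = s := by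
  obtain ⟨v, uvu, vuv, hperp⟩ := (mem_quasiInvertibles_iff s).1 hs
  obtain ⟨u, rfl⟩ := hf s
  obtain ⟨v, rfl⟩ := hf v
  obtain ⟨y, hy⟩ := hR u (1 - v * u) ⟨v, 1, by simp⟩
  obtain ⟨w, hw⟩ : ∃ w, w = u + y * (1 - v * u) := ⟨_, rfl⟩
  rw [← hw] at hy
  obtain ⟨w', www, -, -⟩ := (mem_quasiInvertibles_iff w).1 hy
  -- In S one has f w = f u (1 + f n) with (f n)² = 0, but n² need not vanish in R. The element (1 -
  -- k) n k below does square to zero, and f(nk) = f n.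
  obtain ⟨n, hn⟩ : ∃ n, n = v * y * (1 - v * u) := ⟨_, rfl⟩
  obtain ⟨φ, hφ⟩ : ∃ φ, φ = (1 - n) * (1 - v * u) * (1 + n) := ⟨_, rfl⟩
  -- the kernel projection of `w`, corrected so that it lifts the one of `f u * (1 + f n)`
  obtain ⟨k, hk⟩ : ∃ k, k = (1 - w' * w) * (1 + φ * (w' * w)) := ⟨_, rfl⟩
  have wk : w * k = 0 := by
    rw [hk]
    linear_combination (norm := noncomm_ring) - www * (1 + φ * (w' * w))
  have kk : k * k = k := by
    have h1 : k * (1 - w' * w) = 1 - w' * w := by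
      rw [hk]
      linear_combination (norm := noncomm_ring) w' * www
        - (1 - w' * w) * φ * w' * www
    have h2 : k * (1 - w' * w) * (1 + φ * (w' * w)) = k := by rw [h1, hk]
    rw [mul_assoc, ← hk] at h2
    exact h2
  refine ⟨w * (1 - (1 - k) * n * k), mem_quasiInvertibles_mul
    (g' := 1 + (1 - k) * n * k) ?_ ?_ hy, ?_⟩
  · linear_combination (norm := noncomm_ring) (1 - k) * n * kk * n * k
  · linear_combination (norm := noncomm_ring) (1 - k) * n * kk * n * k
  have e1 : w * (1 - (1 - k) * n * k) = w * (1 - n * k) := by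
    linear_combination (norm := noncomm_ring) wk * n * k
  have qv : (1 - f v * f u) * f v = 0 := by rw [sub_mul, vuv, one_mul, sub_self]
  have uq : f u * (1 - f v * f u) = 0 := by rw [mul_sub, ← mul_assoc, uvu, mul_one, sub_self]
  have qq : (1 - f v * f u) * (1 - f v * f u) = 1 - f v * f u := by
    linear_combination (norm := noncomm_ring) - qv * f u
  have hN : f n = f v * f y * (1 - f v * f u) := by simp [hn]
  have nq : f n * (1 - f v * f u) = f n := by rw [hN, mul_assoc _ _ (1 - f v * f u), qq]
  have qn : (1 - f v * f u) * f n = 0 := by rw [hN, ← mul_assoc, ← mul_assoc, qv]; simp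
  have nn : f n * f n = 0 := by rw [← nq, mul_assoc, nq, qn, mul_zero]
  have hW : f w = f u * (1 + f n) := by
    have := hperp.1 (f y)
    rw [hw, hN, map_add, map_mul, map_sub, map_one, map_mul]
    linear_combination (norm := noncomm_ring) this
  have hΦ : f φ = (1 - f n) * (1 - f v * f u) * (1 + f n) := by simp [hφ]
  have wφ : f w * f φ = 0 := by
    rw [hW, hΦ]
    linear_combination (norm := noncomm_ring) uq * (1 + f n)
      - f u * nn * (1 - f v * f u) * (1 + f n)
  have φ1 : 1 - f φ = (1 - f n) * f v * f w := by
    rw [hW, hΦ]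
    linear_combination (norm := noncomm_ring) nn
  have hW' : f w * f w' * f w = f w := by rw [← map_mul, ← map_mul, www]
  have hkφ : f k = f φ := by
    have h1 : f k = (1 - f w' * f w) * (1 + f φ * (f w' * f w)) := by simp [hk]
    rw [h1]
    linear_combination (norm := noncomm_ring) - f w' * wφ * f w' * f w
      + φ1 * (1 - f w' * f w) - (1 - f n) * f v * hW'
  have nφ : f n * f φ = f n := by
    rw [hΦ]
    linear_combination (norm := noncomm_ring) nq * (1 + f n) + nn
      - nn * (1 - f v * f u) * (1 + f n)
  rw [e1, map_mul, map_sub, map_mul, map_one, hkφ, nφ, hW]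
  linear_combination (norm := noncomm_ring) - f u * nn

theorem IsQBRing.isQBIdeal (hR : IsQBRing R) (I : Ideal R) [I.IsTwoSided] : IsQBIdeal I := by
  intro x hx a ha b hb h
  have h1 : (1 + b) * (1 - x) * (1 - a) + 1 * (b * b) = 1 := by
    linear_combination (norm := noncomm_ring) (1 + b) * h
  -- Using b² in place of b puts the coefficient yb in I.
  obtain ⟨y, hy⟩ := hR (1 - a) (b * b) ⟨_, _, h1⟩
  refine ⟨y * b, I.mul_mem_left _ hb, ?_⟩
  rwa [sub_sub_eq_add_sub, add_sub_right_comm, mul_assoc]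

/-! ### The converse: regularizing products and extending through the ideal. -/

set_option linter.unusedSimpArgs false in
/-- For idempotents `e`, `f`, the product `e * f` is regularized in `eRf`, with prescribed partner
`x`, by means of the complementary corner `(1 - f)R(1 - e)`. -/
theorem exists_regularization_mul {e f x : R} (he : e * e = e) (hf : f * f = f)
    (fx : f * x = x) (xe : x * e = x)
    (h : ∀ a ∈ skewCorner (1 - f) (1 - e), ∀ r ∈ skewCorner (1 - e) (1 - f),
      ∃ y ∈ skewCorner (1 - f) (1 - e),
        a + ((1 - f) - a * r) * y ∈ cornerQuasiInvertibles (1 - f) (1 - e)) :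
    ∃ y d d' s t g g' k k' : R, d = e * f + y * (1 - e) * (f - x * e * f) ∧
      e * d = d ∧ d * f = d ∧ e - d * d' = g * ((1 - f) * s) * g' ∧
      f - d' * d = k * ((1 - e) * t) * k' ∧
      CentrallyOrthogonal ((1 - f) * s) ((1 - e) * t) := by
  have he' : (1 - e) * (1 - e) = 1 - e := by linear_combination (norm := noncomm_ring) he
  have hf' : (1 - f) * (1 - f) = 1 - f := by linear_combination (norm := noncomm_ring) hf
  obtain ⟨y, hy, -, θ, hθ, hperp⟩ := h ((1 - f) * (1 - e))
    ((mem_skewCorner_iff hf' he').2 ⟨by rw [← mul_assoc, hf'], by rw [mul_assoc, he']⟩)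
    ((1 - e) * (1 - x) * (1 - f)) ⟨_, rfl⟩
  obtain ⟨hy1, hy2⟩ := (mem_skewCorner_iff hf' he').1 hy
  obtain ⟨hθ1, -⟩ := (mem_skewCorner_iff he' hf').1 hθ
  have fy : f * y = 0 := by linear_combination (norm := noncomm_ring) - hy1
  have ye : y * e = 0 := by linear_combination (norm := noncomm_ring) - hy2
  obtain ⟨π, hπ⟩ : ∃ π, π = (1 - f) * (1 - e) + (1 - f - (1 - f) * (1 - e) *
      ((1 - e) * (1 - x) * (1 - f))) * y := ⟨_, rfl⟩
  rw [← hπ] at hperp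
  have R1 := mul_mul_of_mul_eq he
  have R2 := mul_mul_of_mul_eq hf
  have R3 := mul_mul_of_mul_eq fx
  have R4 := mul_mul_of_mul_eq xe
  have R5 := mul_mul_of_mul_eq fy
  have R6 := mul_mul_of_mul_eq ye
  have fπ : (1 - f) * π = π := by
    rw [hπ]
    linear_combination (norm := noncomm_ring) hf' * (1 - e) + (hf' - hf' * (1 - e) *
      ((1 - e) * (1 - x) * (1 - f))) * y
  -- The identity map, cut into blocks by e and f and changed by elementary operations, suggests a
  -- matrix with first row d, G and first column d, D, and an inverse with rows A, B and C, π. Thus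
  -- d and π are complementary blocks: `i1` to `i4` turn a partner θ of π into the partner A - BθC
  -- of d, with defects factoring through those of π.
  obtain ⟨Y, hY⟩ : ∃ Y, Y = - (e * (1 - f) * y) := ⟨_, rfl⟩
  obtain ⟨d, hd⟩ : ∃ d, d = e * f + Y * (1 - e) * (f - x * e * f) := ⟨_, rfl⟩
  obtain ⟨A, hA⟩ : ∃ A, A = f * e + f * (1 - e) * x := ⟨_, rfl⟩
  obtain ⟨B, hB⟩ : ∃ B, B = f * (1 - e) - A * Y := ⟨_, rfl⟩
  obtain ⟨C, hC⟩ : ∃ C, C = (1 - f) * e + (1 - f) * (1 - e) * x := ⟨_, rfl⟩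
  obtain ⟨D, hD⟩ : ∃ D, D = (1 - e) * (f - x * e * f) := ⟨_, rfl⟩
  obtain ⟨G, hG⟩ : ∃ G, G = e * (1 - f) + Y * ((1 - e) * (1 - f) - (1 - e) * x * e * (1 - f)) :=
    ⟨_, rfl⟩
  have i1 : d * A + G * C = e := by
    simp only [hd, hA, hG, hC, hY, mul_add, add_mul, mul_sub, sub_mul, mul_assoc, mul_one, one_mul,
      mul_neg, neg_mul, mul_zero, zero_mul, he, hf, fx, xe, fy, ye, R1, R2, R3, R4, R5, R6]
    abel
  have i2 : d * B + G * π = 0 := by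
    simp only [hd, hB, hA, hG, hπ, hY, mul_add, add_mul, mul_sub, sub_mul, mul_assoc, mul_one,
      one_mul, mul_neg, neg_mul, mul_zero, zero_mul, he, hf, fx, xe, fy, ye, R1, R2, R3, R4, R5, R6]
    abel
  have i3 : A * d + B * D = f := by
    simp only [hd, hB, hA, hD, hY, mul_add, add_mul, mul_sub, sub_mul, mul_assoc, mul_one,
      one_mul, mul_neg, neg_mul, mul_zero, zero_mul, he, hf, fx, xe, fy, ye, R1, R2, R3, R4, R5, R6]
    abel
  have i4 : C * d + π * D = 0 := by
    simp only [hd, hC, hD, hπ, hY, mul_add, add_mul, mul_sub, sub_mul, mul_assoc, mul_one,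
      one_mul, mul_neg, neg_mul, mul_zero, zero_mul, he, hf, fx, xe, fy, ye, R1, R2, R3, R4, R5, R6]
    abel
  have s1 : (1 - f) * (1 - f - π * θ) = 1 - f - π * θ := by
    linear_combination (norm := noncomm_ring) hf' - fπ * θ
  have t1 : (1 - e) * (1 - e - θ * π) = 1 - e - θ * π := by
    linear_combination (norm := noncomm_ring) he' - hθ1 * π
  have fC : (1 - f) * C = C := by
    rw [hC]
    linear_combination (norm := noncomm_ring) hf' * e + hf' * (1 - e) * x
  have eD : (1 - e) * D = D := by
    rw [hD]
    linear_combination (norm := noncomm_ring) he' * (f - x * e * f)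
  refine ⟨Y, d, A - B * θ * C, 1 - f - π * θ, 1 - e - θ * π, G, C, B, D, hd, ?_, ?_, ?_, ?_, ?_⟩
  · rw [hd, hY]
    linear_combination (norm := noncomm_ring) he * f
      - he * (1 - f) * y * (1 - e) * (f - x * e * f)
  · rw [hd]
    linear_combination (norm := noncomm_ring) e * hf + Y * (1 - e) * (1 - x * e) * hf
  · rw [s1]
    linear_combination (norm := noncomm_ring) - i1 + i2 * θ * C - G * fC
  · rw [t1]
    linear_combination (norm := noncomm_ring) - i3 + B * θ * i4 - B * eD
  · rw [s1, t1]
    exact hperp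

theorem exists_add_mul_mem_of_corner_mem {u v w z a x : R} (huv : IsQuasiInverse u v)
    (hwz : IsQuasiInverse w z) (ha : a ∈ cornerQuasiInvertibles (1 - u * v) (1 - z * w))
    (h : ∀ a ∈ skewCorner (1 - w * z) (1 - v * u), ∀ r ∈ skewCorner (1 - v * u) (1 - w * z),
      ∃ y ∈ skewCorner (1 - w * z) (1 - v * u),
        a + ((1 - w * z) - a * r) * y ∈ cornerQuasiInvertibles (1 - w * z) (1 - v * u)) :
    ∃ y, a + u * w + y * (1 - x * (a + u * w)) ∈ quasiInvertibles R := by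
  have hpp := huv.idem
  have hqq := hwz.symm.idem
  obtain ⟨uvu, vuv, hperp⟩ := huv
  obtain ⟨wzw, zwz, hperp'⟩ := hwz
  obtain ⟨ha, b, hb, hab⟩ := ha
  rw [mem_skewCorner_iff hpp hqq] at ha
  rw [mem_skewCorner_iff hqq hpp] at hb
  obtain ⟨pa, aq⟩ := ha
  obtain ⟨qb, bp⟩ := hb
  have az : a * z = 0 := by
    linear_combination (norm := noncomm_ring) - aq * z - a * zwz
  have wb : w * b = 0 := by
    linear_combination (norm := noncomm_ring) - w * qb - wzw * b
  have va : v * a = 0 := by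
    linear_combination (norm := noncomm_ring) - v * pa - vuv * a
  have bu : b * u = 0 := by
    linear_combination (norm := noncomm_ring) - bp * u - b * uvu
  obtain ⟨y, d, d', s, t, g, g', k, k', hd, ed, df, h1, h2, hst⟩ :=
    exists_regularization_mul (e := v * u) (f := w * z) (x := w * x * u)
      (by rw [← mul_assoc, vuv]) (by rw [← mul_assoc, wzw])
      (by rw [← mul_assoc, ← mul_assoc, wzw])
      (by rw [mul_assoc, ← mul_assoc u, uvu]) h
  -- The perturbation replaces uw by udw and leaves a alone, since 1 - vu ⊥ 1 - uv. Each defect then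
  -- has two summands, giving the four orthogonalities `c1` to `c4`.
  refine ⟨u * y * (1 - v * u) * w, b + z * d' * v, ?_⟩
  have hW : a + u * w + u * y * (1 - v * u) * w * (1 - x * (a + u * w)) = a + u * d * w := by
    have := hperp.2 (w * x)
    rw [hd]
    linear_combination (norm := noncomm_ring) - u * y * this * a
      + u * y * (1 - v * u) * w * x * pa
      - uvu * w - u * v * u * wzw - u * y * (1 - v * u) * wzw
      + u * y * (1 - v * u) * w * x * (uvu * w + u * v * u * wzw)
  rw [hW]
  have e1 : 1 - (a + u * d * w) * (b + z * d' * v) =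
      (1 - u * v) * (1 - u * v - a * b) * 1 +
        u * g * ((1 - w * z) * s) * (g' * v) := by
    linear_combination (norm := noncomm_ring) u * h1 * v - hpp + pa * b - az * d' * v
      - u * d * wb - u * df * d' * v - uvu * v
  have e2 : 1 - (b + z * d' * v) * (a + u * d * w) =
      (1 - z * w) * (1 - z * w - b * a) * 1 +
        z * k * ((1 - v * u) * t) * (k' * w) := by
    linear_combination (norm := noncomm_ring) z * h2 * w - hqq + qb * a - z * d' * va
      - bu * d * w - z * d' * ed * w - z * wzw
  rw [e1, e2]
  have c1 : CentrallyOrthogonal ((1 - u * v) * (1 - u * v - a * b) * 1)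
      ((1 - z * w) * (1 - z * w - b * a) * 1) := by
    have p1 : (1 - u * v) * (1 - u * v - a * b) = 1 - u * v - a * b := by
      linear_combination (norm := noncomm_ring) hpp - pa * b
    have q1 : (1 - z * w) * (1 - z * w - b * a) = 1 - z * w - b * a := by
      linear_combination (norm := noncomm_ring) hqq - qb * a
    rw [p1, q1, mul_one, mul_one]
    exact hab
  have c2 := hperp.mul_mul 1 ((1 - u * v - a * b) * 1) (z * k) (t * (k' * w))
  have c3 := hperp'.mul_mul (u * g) (s * (g' * v)) 1 ((1 - z * w - b * a) * 1)
  have c4 := hst.mul_mul (u * g) (g' * v) (z * k) (k' * w)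
  simp only [mul_assoc, one_mul, mul_one] at c1 c2 c3 c4 ⊢
  exact (c1.add_right c2).add_left (c3.add_right c4)

theorem exists_add_mul_mem_of_diagonal {u v w z a x : R} (huv : IsQuasiInverse u v)
    (hwz : IsQuasiInverse w z) (ha : a ∈ skewCorner (1 - u * v) (1 - z * w))
    (h : CentrallyOrthogonal (1 - u * v) (1 - z * w) ∨ IsQBCorner (1 - u * v) (1 - z * w))
    (h' : CentrallyOrthogonal (1 - w * z) (1 - v * u) ∨ IsQBCorner (1 - w * z) (1 - v * u)) :
    ∃ y, a + u * w + y * (1 - x * (a + u * w)) ∈ quasiInvertibles R := by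
  have hpp := huv.idem
  have hqq := hwz.symm.idem
  obtain ⟨y, hy, hay⟩ := exists_add_mul_mem_of_or hpp hqq h ha
    (x := (1 - z * w) * x * (1 - u * v)) ⟨x, rfl⟩
  obtain ⟨pa, aq⟩ := (mem_skewCorner_iff hpp hqq).1 ha
  obtain ⟨py, yq⟩ := (mem_skewCorner_iff hpp hqq).1 hy
  have va : v * a = 0 := by
    linear_combination (norm := noncomm_ring) - v * pa - huv.2.1 * a
  have vy : v * y = 0 := by
    linear_combination (norm := noncomm_ring) - v * py - huv.2.1 * y
  -- The unit 1 + m removes the unwanted term -yxuw introduced by adding yb, leaving the repaired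
  -- corner element plus uw.
  obtain ⟨m, hm⟩ : ∃ m, m = y * x * u * v := ⟨_, rfl⟩
  have mm : m * m = 0 := by
    rw [hm]
    linear_combination (norm := noncomm_ring) y * x * u * vy * x * u * v
  have m1 : (1 + m) * (1 - m) = 1 := by linear_combination (norm := noncomm_ring) - mm
  have m2 : (1 - m) * (1 + m) = 1 := by linear_combination (norm := noncomm_ring) - mm
  obtain ⟨b, hb⟩ : ∃ b, b = 1 - x * (a + u * w) := ⟨_, rfl⟩
  have key : (1 + m) * (a + u * w + y * b) =
      a + y * (1 - z * w - (1 - z * w) * x * (1 - u * v) * a) + u * w := by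
    rw [hm, hb]
    linear_combination (norm := noncomm_ring) - y * x * u * va + y * x * huv.1 * w
      + y * x * u * vy * (1 - x * (a + u * w)) - yq - y * x * pa + yq * x * (1 - u * v) * a
  obtain ⟨y', hy'⟩ := exists_add_mul_mem_of_corner_mem (x := x * (1 - m)) huv hwz hay
    fun a ha r hr => exists_add_sub_mul_mem_of_or hwz.idem huv.symm.idem h' ha hr
  refine ⟨y + (1 - m) * y' * (1 - x * y), ?_⟩
  rw [← key] at hy'
  convert mul_mem_quasiInvertibles m2 m1 hy' using 1
  rw [← hb]
  linear_combination (norm := (rw [hb]; noncomm_ring)) - m2 * (a + u * w + y * b)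
    + (1 - m) * y' * x * m2 * (a + u * w + y * b)

/-- The key extension step: perturbations of quasi-invertible elements by elements of the ideal. -/
theorem exists_add_mul_mem_of_add {I : Ideal R} [I.IsTwoSided] (hI : IsQBIdeal I)
    (h : ∀ p q : R, IsDefectIdempotent p → IsDefectIdempotent q → (p ∈ I ∨ q ∈ I) →
      (CentrallyOrthogonal p q ∨ IsQBCorner p q))
    {u i b x z : R} (hu : u ∈ quasiInvertibles R) (hi : i ∈ I)
    (hx : x * (u + i) + z * b = 1) : ∃ y, u + i + y * b ∈ quasiInvertibles R := by
  obtain ⟨v, huv⟩ := (mem_quasiInvertibles_iff u).1 hu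
  have uvu := huv.1
  have vuv := huv.2.1
  have hperp := huv.2.2
  have pu : (1 - u * v) * u = 0 := by rw [sub_mul, uvu, one_mul, sub_self]
  have vp : v * (1 - u * v) = 0 := by rw [mul_sub, ← mul_assoc, vuv, mul_one, sub_self]
  -- The required relation in I is `hx` multiplied on the left by vi. It makes 1 + vi
  -- quasi-invertible after a correction in I.
  obtain ⟨y₁, hy₁, hc⟩ := hI (v * i * x * u) (I.mul_mem_right _ (I.mul_mem_right _
    (I.mul_mem_left _ hi))) (- (v * i)) (I.neg_mem (I.mul_mem_left _ hi))
    (- (v * i * (x * (1 - u * v) * i + z * b))) (I.neg_mem (I.mul_mem_right _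
    (I.mul_mem_left _ hi))) (by
      linear_combination (norm := noncomm_ring) - v * i * hx)
  obtain ⟨y₂, hy₂⟩ : ∃ y₂, y₂ = - (y₁ * v * i) := ⟨_, rfl⟩
  have hy₂I : y₂ ∈ I := hy₂ ▸ I.neg_mem (I.mul_mem_left _ hi)
  obtain ⟨c, hce⟩ : ∃ c, c = 1 + v * i + y₂ * (x * (1 - u * v) * i + z * b) := ⟨_, rfl⟩
  have hc : c ∈ quasiInvertibles R := by
    convert hc using 1
    rw [hce, hy₂]
    noncomm_ring
  have hcI : 1 - c ∈ I := by
    have : 1 - c = - (v * i + y₂ * (x * (1 - u * v) * i + z * b)) := by rw [hce]; noncomm_ring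
    rw [this]
    exact I.neg_mem (I.add_mem (I.mul_mem_left _ hi) (I.mul_mem_right _ hy₂I))
  obtain ⟨d, hcd⟩ := (mem_quasiInvertibles_iff c).1 hc
  have cdc := hcd.1
  have hsI : 1 - c * d ∈ I := by
    have : 1 - c * d = (1 - c * d) * (1 - c) := by
      linear_combination (norm := noncomm_ring) - cdc
    rw [this]
    exact I.mul_mem_left _ hcI
  have htI : 1 - d * c ∈ I := by
    have : 1 - d * c = (1 - c) * (1 - d * c) := by
      linear_combination (norm := noncomm_ring) - cdc
    rw [this]
    exact I.mul_mem_right _ hcI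
  obtain ⟨α, hα⟩ : ∃ α, α = (1 - u * v) * i * (1 - d * c) := ⟨_, rfl⟩
  -- The unit 1 + m produces uc + (1 - uv)i; then 1 - n clears the part of (1 - uv)i divisible on
  -- the right by dc, leaving α + uc.
  obtain ⟨m, hm⟩ : ∃ m, m = u * y₂ * x * (1 - u * v) := ⟨_, rfl⟩
  obtain ⟨n, hn⟩ : ∃ n, n = (1 - u * v) * i * d * v := ⟨_, rfl⟩
  have mm : m * m = 0 := by
    rw [hm]
    linear_combination (norm := noncomm_ring) u * y₂ * x * pu * y₂ * x * (1 - u * v)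
  have nn : n * n = 0 := by
    rw [hn]
    linear_combination (norm := noncomm_ring) (1 - u * v) * i * d * vp * i * d * v
  have m1 : (1 + m) * (1 - m) = 1 := by linear_combination (norm := noncomm_ring) - mm
  have m2 : (1 - m) * (1 + m) = 1 := by linear_combination (norm := noncomm_ring) - mm
  have n1 : (1 + n) * (1 - n) = 1 := by linear_combination (norm := noncomm_ring) - nn
  have n2 : (1 - n) * (1 + n) = 1 := by linear_combination (norm := noncomm_ring) - nn
  have key₁ : (1 + m) * (u + i + u * y₂ * z * b) = u * c + (1 - u * v) * i := by
    rw [hm, hce]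
    linear_combination (norm := noncomm_ring) u * y₂ * x * pu * (1 + y₂ * z * b)
  have key₂ : (1 - n) * (u * c + (1 - u * v) * i) = α + u * c := by
    have := hperp.1 (i * d)
    rw [hn, hα]
    linear_combination (norm := noncomm_ring) this * c - (1 - u * v) * i * d * vp * i
  obtain ⟨y₃, hy₃⟩ := exists_add_mul_mem_of_diagonal (a := α) (x := x * (1 - m) * (1 + n)) huv hcd
    ⟨i, hα⟩ (h _ _ ⟨u, v, huv, Or.inl rfl⟩ ⟨c, d, hcd, Or.inr rfl⟩ (Or.inr htI))
    (h _ _ ⟨c, d, hcd, Or.inl rfl⟩ ⟨u, v, huv, Or.inr rfl⟩ (Or.inl hsI))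
  have hb : 1 - x * (1 - m) * (1 + n) * (α + u * c) = (1 - x * u * y₂) * z * b := by
    rw [← key₂, ← key₁]
    linear_combination (norm := noncomm_ring)
      - x * (1 - m) * n1 * (1 + m) * (u + i + u * y₂ * z * b)
      - x * m2 * (u + i + u * y₂ * z * b) - hx
  rw [hb, ← key₂, ← key₁] at hy₃
  refine ⟨u * y₂ * z + (1 - m) * (1 + n) * y₃ * ((1 - x * u * y₂) * z), ?_⟩
  convert mul_mem_quasiInvertibles m2 m1 (mul_mem_quasiInvertibles n1 n2 hy₃) using 1
  linear_combination (norm := noncomm_ring)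
    - (1 - m) * n1 * (1 + m) * (u + i + u * y₂ * z * b) - m2 * (u + i + u * y₂ * z * b)

end QBRing

theorem theorem1p6 {R : Type*} [Ring R] (I : Ideal R) [I.IsTwoSided] :
    QBRing.IsQBRing R ↔
      (QBRing.IsQBRing (R ⧸ I) ∧
        QBRing.quasiInvertibles (R ⧸ I) =
          (Ideal.Quotient.mk I) '' QBRing.quasiInvertibles R ∧
        (QBRing.IsQBIdeal I ∧
          ∀ p q : R, QBRing.IsDefectIdempotent p → QBRing.IsDefectIdempotent q →
            (p ∈ I ∨ q ∈ I) →
              (QBRing.CentrallyOrthogonal p q ∨ QBRing.IsQBCorner p q))) := by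
  have hs : Function.Surjective (Ideal.Quotient.mk I) := Ideal.Quotient.mk_surjective
  constructor
  · intro hR
    refine ⟨hR.of_surjective hs, Set.Subset.antisymm (fun s => hR.exists_map_eq hs) ?_,
      hR.isQBIdeal I, fun p q hp hq _ => hR.centrallyOrthogonal_or_isQBCorner hp hq⟩
    rintro _ ⟨r, hr, rfl⟩
    exact QBRing.map_mem_quasiInvertibles hs hr
  · rintro ⟨hQ, hlift, hI, hpq⟩ a b ⟨x, z, hx⟩
    obtain ⟨y, hy⟩ := hQ (Ideal.Quotient.mk I a) (Ideal.Quotient.mk I b)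
      ⟨Ideal.Quotient.mk I x, Ideal.Quotient.mk I z, by rw [← map_mul, ← map_mul, ← map_add, hx,
        map_one]⟩
    obtain ⟨y, rfl⟩ := hs y
    rw [hlift] at hy
    obtain ⟨u, hu, hy⟩ := hy
    rw [← map_mul, ← map_add, eq_comm, Ideal.Quotient.mk_eq_mk_iff_sub_mem] at hy
    -- Replacing a by a + yb preserves the unimodular relation once z becomes z - xy.
    obtain ⟨y', hy'⟩ := QBRing.exists_add_mul_mem_of_add hI hpq hu hy (b := b) (x := x)
      (z := z - x * y) (by rw [add_sub_cancel, ← hx]; noncomm_ring)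
    exact ⟨y + y', by rwa [add_sub_cancel, add_assoc, ← add_mul] at hy'⟩
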